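/- Let $P$ be the known joint distribution of $(Y,X,W_1)$, where $Y$ (outcome) and $X$ (treatment) are scalar random variables and $W_1$ is a random vector in $\mathbb{R}^d$. Suppose $\operatorname{var}(Y,X,W_1)$ is finite and positive definite. Let $\beta_{\text{med}}$, $\gamma_{1,\text{med}}$ be the population OLS coefficients on $X$ and on $W_1$, and $R^2_{\text{med}}$ the R-squared, in the regression of $Y$ on $(1,X,W_1)$. Let $\pi_1$ be the coefficient on $W_1$ in the regression of $X$ on $(1,W_1)$, and $X^{\perp W_1}=X-\pi_1'W_1$. Let $R^2_{\text{long}}\in(R^2_{\text{med}},1]$ and $\bar\delta\ge 0$ be known. For a joint distribution of $(Y,X,W_1,W_2)$ with $W_2$ a scalar (unobserved) random variable, let $\beta_{\text{long}},\gamma_{1,\text{long}},\gamma_{2,\text{long}}$ be the OLS coefficients on $X,W_1,W_2$ in the regression of $Y$ on $(1,X,W_1,W_2)$, and consider the following assumptions. - A1: $\operatorname{var}(Y,X,W_1,W_2)$ is finite; $\operatorname{var}(X,W_1,W_2)$ and $\operatorname{var}(Y,X,W_1)$ are positive definite. - A2 (with parameter $\delta\in\mathbb{R}$): $\displaystyle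 \delta\cdot\frac{\operatorname{cov}(X,\gamma_{1,\text{long}}'W_1)}{\operatorname{var}(\gamma_{1,\text{long}}'W_1)}=\frac{\operatorname{cov}(X,\gamma_{2,\text{long}}W_2)}{\operatorname{var}(\gamma_{2,\text{long}}W_2)}$. - A3: $\gamma_{1,\text{long}}\ne 0$ and $\gamma_{2,\text{long}}\neq 0$. - A4: $\operatorname{cov}(W_1,W_2)=0$. - A5: $\operatorname{var}(W_2)=1$. - A6 (for a known $M\ge 0$): $|\beta_{\text{long}}-\beta_{\text{med}}|\le M$. For $\delta\in\mathbb{R}$ define $$\mathcal{B}_I(\delta,R^2_{\text{long}})=\{b\in\mathbb{R}: f_0(\beta_{\text{med}}-b)+\delta f_1(\beta_{\text{med}}-b,R^2_{\text{long}})=0\}\setminus\{b\in\mathbb{R}:\gamma_{1,\text{med}}+(\beta_{\text{med}}-b)\pi_1=0\},$$ where $$f_0(B)=-B\operatorname{var}(X^{\perp W_1})\bigl(\operatorname{var}(\gamma_{1,\text{med}}'W_1)+2B\operatorname{cov}(X,\gamma_{1,\text{med}}'W_1)+B^2\operatorname{var}(\pi_1'W_1)\bigr),$$ $$\begin{aligned}f_1(B,R^2_{\text{long}})={}&(R^2_{\text{long}}-R^2_{\text{med}})\operatorname{var}(Y)\operatorname{cov}(X,\gamma_{1,\text{med}}'W_1)+B(R^2_{\text{long}}-R^2_{\text{med}})\operatorname{var}(Y)\operatorname{var}(\pi_1'W_1)\\&+B^2\operatorname{var}(X^{\perp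 W_1})\operatorname{cov}(X,\gamma_{1,\text{med}}'W_1)+B^3\operatorname{var}(X^{\perp W_1})\operatorname{var}(\pi_1'W_1).\end{aligned}$$ Then the identified set for $\beta_{\text{long}}$, that is, the set of all values of $\beta_{\text{long}}$ over joint distributions of $(Y,X,W_1,W_2)$ whose $(Y,X,W_1)$-marginal is $P$, whose R-squared in the regression of $Y$ on $(1,X,W_1,W_2)$ equals $R^2_{\text{long}}$, and which satisfy A1–A5 for some $\delta$ with $|\delta|\le\bar\delta$, is $$\bigcup_{|\delta|\le\bar\delta}\mathcal{B}_I(\delta,R^2_{\text{long}}).$$ If in addition A6 is imposed for a known $M\ge0$, the identified set for $\beta_{\text{long}}$ is $$\bigcup_{|\delta|\le\bar\delta}\Bigl(\mathcal{B}_I(\delta,R^2_{\text{long}})\cap[\beta_{\text{med}}-M,\beta_{\text{med}}+M]\Bigr).$$ -/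

import Mathlib

open MeasureTheory ProbabilityTheory Matrix

namespace OVB

noncomputable section

/-! ### Population linear regression -/

/-- The variance matrix of a random vector `z = (z i)` under `μ`. -/
def varMatrix {Ω ι : Type*} [MeasurableSpace Ω] (μ : Measure Ω) (z : ι → Ω → ℝ) :
    Matrix ι ι ℝ :=
  Matrix.of fun i j => cov[z i, z j; μ]

/-- The random variable `c' z = ∑ i, c i * z i`. -/
def linComb {Ω ι : Type*} [Fintype ι] (c : ι → ℝ) (z : ι → Ω → ℝ) : Ω → ℝ :=
  fun ω => ∑ i, c i * z i ω

/-- The slope coefficients `var(z)⁻¹ cov(z, y)` of the population OLS regression of `y` on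
`(1, z)`.  It is used only where `var(z)` is positive definite. -/
def olsCoef {Ω ι : Type*} [MeasurableSpace Ω] [Fintype ι] [DecidableEq ι] (μ : Measure Ω)
    (y : Ω → ℝ) (z : ι → Ω → ℝ) : ι → ℝ :=
  (varMatrix μ z)⁻¹ *ᵥ fun i => cov[z i, y; μ]

/-- The population R-squared of the OLS regression of `y` on `(1, z)`: the variance of the fitted
value divided by the variance of `y`. -/
def rSquared {Ω ι : Type*} [MeasurableSpace Ω] [Fintype ι] [DecidableEq ι] (μ : Measure Ω)
    (y : Ω → ℝ) (z : ι → Ω → ℝ) : ℝ :=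
  Var[linComb (olsCoef μ y z) z; μ] / Var[y; μ]

/-! ### The observed vector `(Y, X, W₁)` -/

/-- Values of the observed vector `(Y, X, W₁)`, where `W₁` has `d` components. -/
abbrev Obs (d : ℕ) : Type := ℝ × ℝ × (Fin d → ℝ)

/-- The outcome. -/
def obsY {d : ℕ} : Obs d → ℝ := fun p => p.1

/-- The treatment. -/
def obsX {d : ℕ} : Obs d → ℝ := fun p => p.2.1

/-- The observed covariates. -/
def obsW1 {d : ℕ} : Fin d → Obs d → ℝ := fun j p => p.2.2 j

/-- The vector `(X, W₁)` of regressors of the medium regression. -/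
def medRegressors {d : ℕ} : Unit ⊕ Fin d → Obs d → ℝ :=
  Sum.elim (fun _ => obsX) obsW1

/-- The whole observed vector `(Y, X, W₁)`. -/
def obsVector {d : ℕ} : Unit ⊕ (Unit ⊕ Fin d) → Obs d → ℝ :=
  Sum.elim (fun _ => obsY) medRegressors

/-- `β_med`: coefficient on `X` in the regression of `Y` on `(1, X, W₁)`. -/
def betaMed {d : ℕ} (P : Measure (Obs d)) : ℝ :=
  olsCoef P obsY medRegressors (Sum.inl ())

/-- `γ_{1,med}`: coefficients on `W₁` in the regression of `Y` on `(1, X, W₁)`. -/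
def gammaMed {d : ℕ} (P : Measure (Obs d)) : Fin d → ℝ :=
  fun j => olsCoef P obsY medRegressors (Sum.inr j)

/-- `R²_med`. -/
def rSquaredMed {d : ℕ} (P : Measure (Obs d)) : ℝ :=
  rSquared P obsY medRegressors

/-- `π₁`: coefficients in the regression of `X` on `(1, W₁)`. -/
def piOne {d : ℕ} (P : Measure (Obs d)) : Fin d → ℝ :=
  olsCoef P obsX obsW1

/-- `X^{⊥W₁} = X - π₁' W₁`. -/
def xPerp {d : ℕ} (P : Measure (Obs d)) : Obs d → ℝ :=
  fun p => obsX p - linComb (piOne P) obsW1 p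

/-! ### The sets `B_I(δ, R²_long)` and `B_I(δ, R²_long, M)` -/

/-- `f₀(B)`. -/
def fZero {d : ℕ} (P : Measure (Obs d)) (B : ℝ) : ℝ :=
  -B * Var[xPerp P; P] *
    (Var[linComb (gammaMed P) obsW1; P]
      + 2 * B * cov[obsX, linComb (gammaMed P) obsW1; P]
      + B ^ 2 * Var[linComb (piOne P) obsW1; P])

/-- `f₁(B, R²_long)`. -/
def fOne {d : ℕ} (P : Measure (Obs d)) (B R2 : ℝ) : ℝ :=
  (R2 - rSquaredMed P) * Var[obsY; P] * cov[obsX, linComb (gammaMed P) obsW1; P]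
    + B * (R2 - rSquaredMed P) * Var[obsY; P] * Var[linComb (piOne P) obsW1; P]
    + B ^ 2 * Var[xPerp P; P] * cov[obsX, linComb (gammaMed P) obsW1; P]
    + B ^ 3 * Var[xPerp P; P] * Var[linComb (piOne P) obsW1; P]

/-- The set of `b` with `γ_{1,med} + (β_med - b) π₁ = 0`. -/
def exceptionalSet {d : ℕ} (P : Measure (Obs d)) : Set ℝ :=
  {b | gammaMed P + (betaMed P - b) • piOne P = 0}

/-- `B_I(δ, R²_long)`: the roots `b` of `f₀(β_med - b) + δ f₁(β_med - b, R²_long) = 0` outside the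
exceptional set. -/
def setBI {d : ℕ} (P : Measure (Obs d)) (δ R2 : ℝ) : Set ℝ :=
  {b | fZero P (betaMed P - b) + δ * fOne P (betaMed P - b) R2 = 0} \ exceptionalSet P

/-- `B_I(δ, R²_long, M)`. -/
def setBIMag {d : ℕ} (P : Measure (Obs d)) (δ R2 M : ℝ) : Set ℝ :=
  setBI P δ R2 ∩ Set.Icc (betaMed P - M) (betaMed P + M)

/-! ### The full vector `((Y, X, W₁), W₂)` and the long regression -/

/-- Values of the full vector `((Y, X, W₁), W₂)` with a scalar unobserved covariate `W₂`. -/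
abbrev Full (d : ℕ) : Type := Obs d × ℝ

/-- The outcome as a function of the full vector. -/
def fullY {d : ℕ} : Full d → ℝ := fun q => obsY q.1

/-- The treatment as a function of the full vector. -/
def fullX {d : ℕ} : Full d → ℝ := fun q => obsX q.1

/-- The observed covariates as functions of the full vector. -/
def fullW1 {d : ℕ} : Fin d → Full d → ℝ := fun j q => obsW1 j q.1

/-- The unobserved covariate. -/
def fullW2 {d : ℕ} : Full d → ℝ := fun q => q.2

/-- The vector `(X, W₁, W₂)` of regressors of the long regression. -/
def longRegressors {d : ℕ} : Unit ⊕ (Fin d ⊕ Unit) → Full d → ℝ :=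
  Sum.elim (fun _ => fullX) (Sum.elim fullW1 fun _ => fullW2)

/-- `β_long`: coefficient on `X` in the regression of `Y` on `(1, X, W₁, W₂)`. -/
def betaLong {d : ℕ} (Q : Measure (Full d)) : ℝ :=
  olsCoef Q fullY longRegressors (Sum.inl ())

/-- `γ_{1,long}`: coefficients on `W₁` in the long regression. -/
def gammaOneLong {d : ℕ} (Q : Measure (Full d)) : Fin d → ℝ :=
  fun j => olsCoef Q fullY longRegressors (Sum.inr (Sum.inl j))

/-- `γ_{2,long}`: coefficient on `W₂` in the long regression. -/
def gammaTwoLong {d : ℕ} (Q : Measure (Full d)) : ℝ :=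
  olsCoef Q fullY longRegressors (Sum.inr (Sum.inr ()))

/-- `R²_long`. -/
def rSquaredLong {d : ℕ} (Q : Measure (Full d)) : ℝ :=
  rSquared Q fullY longRegressors

/-- The index `γ_{1,long}' W₁`. -/
def indexOne {d : ℕ} (Q : Measure (Full d)) : Full d → ℝ :=
  linComb (gammaOneLong Q) fullW1

/-- The index `γ_{2,long} W₂`. -/
def indexTwo {d : ℕ} (Q : Measure (Full d)) : Full d → ℝ :=
  fun q => gammaTwoLong Q * fullW2 q

/-! ### Assumptions -/

/-- `var(Y, X, W₁)` is finite and positive definite: the restriction that the model puts on the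
observed distribution. -/
structure ObsRegular {d : ℕ} (P : Measure (Obs d)) : Prop where
  finite_var : ∀ i, MemLp (obsVector (d := d) i) 2 P
  posDef : (varMatrix P (obsVector (d := d))).PosDef

/-- A1: `var(Y, X, W₁, W₂)` is finite, and `var(X, W₁, W₂)` and `var(Y, X, W₁)` are positive
definite. -/
structure AssumptionA1 {d : ℕ} (Q : Measure (Full d)) : Prop where
  finite_var_Y : MemLp (fullY (d := d)) 2 Q
  finite_var_long : ∀ i, MemLp (longRegressors (d := d) i) 2 Q
  posDef_long : (varMatrix Q (longRegressors (d := d))).PosDef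
  posDef_obs : (varMatrix Q fun i q => obsVector (d := d) i q.1).PosDef

/-- A2, for a given `δ`:
`δ · cov(X, γ₁'W₁) / var(γ₁'W₁) = cov(X, γ₂W₂) / var(γ₂W₂)` with the long coefficients. -/
def AssumptionA2 {d : ℕ} (Q : Measure (Full d)) (δ : ℝ) : Prop :=
  δ * (cov[fullX, indexOne Q; Q] / Var[indexOne Q; Q])
    = cov[fullX, indexTwo Q; Q] / Var[indexTwo Q; Q]

/-- A3: `γ_{1,long} ≠ 0` and `γ_{2,long} ≠ 0`. -/
def AssumptionA3 {d : ℕ} (Q : Measure (Full d)) : Prop :=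
  gammaOneLong Q ≠ 0 ∧ gammaTwoLong Q ≠ 0

/-- A4 (exogenous controls): `cov(W₁, W₂) = 0`. -/
def AssumptionA4 {d : ℕ} (Q : Measure (Full d)) : Prop :=
  ∀ j : Fin d, cov[fullW1 j, fullW2; Q] = 0

/-- A5 (normalization): `var(W₂) = 1`. -/
def AssumptionA5 {d : ℕ} (Q : Measure (Full d)) : Prop :=
  Var[fullW2 (d := d); Q] = 1

/-- `Q` is a joint distribution of `((Y, X, W₁), W₂)` that has the observed marginal `P`, satisfies
A1 to A5 with sensitivity parameter `δ`, and has `R²_long = R2`. -/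
structure Compatible {d : ℕ} (P : Measure (Obs d)) (δ R2 : ℝ) (Q : Measure (Full d)) : Prop where
  isProbabilityMeasure : IsProbabilityMeasure Q
  marginal : Q.map Prod.fst = P
  a1 : AssumptionA1 Q
  a2 : AssumptionA2 Q δ
  a3 : AssumptionA3 Q
  a4 : AssumptionA4 Q
  a5 : AssumptionA5 Q
  r2 : rSquaredLong Q = R2

/-! ### Identified sets -/

/-- The identified set for `β_long` when `δ` is only known to satisfy `|δ| ≤ δbar`: all values that
`β_long` takes over the joint distributions compatible with the observed distribution and the
assumptions. -/
def identifiedSet {d : ℕ} (P : Measure (Obs d)) (δbar R2 : ℝ) : Set ℝ :=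
  {b | ∃ (Q : Measure (Full d)) (δ : ℝ), |δ| ≤ δbar ∧ Compatible P δ R2 Q ∧ betaLong Q = b}

/-- The identified set for `β_long` under the additional magnitude restriction A6,
`|β_long - β_med| ≤ M`. -/
def identifiedSetMag {d : ℕ} (P : Measure (Obs d)) (δbar R2 M : ℝ) : Set ℝ :=
  {b | ∃ (Q : Measure (Full d)) (δ : ℝ), |δ| ≤ δbar ∧ Compatible P δ R2 Q ∧
    |betaLong Q - betaMed P| ≤ M ∧ betaLong Q = b}

end

end OVB

/-! Write `v` for the variance of `X^{⊥W₁}`, `ε` for the residual of the medium regression, `vε` for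
its variance, and `B = β_med - β_long`. The variables `X^{⊥W₁}`, `W₁` and `ε` are mutually
uncorrelated. Since `W₂` has unit variance and is uncorrelated with `W₁`, the long regression
depends on the joint law only through `P` and two numbers, `c = cov(X^{⊥W₁}, W₂)` and `m = cov(ε,
W₂)`.

In these coordinates the normal equations (`Extends.olsCoef_long_iff`) read `γ₁ = γ_med + B π₁`, `B
v = γ₂ c` and `γ₂ = B c + m`. The residual variance then gives `γ₂² = D + B² v` with `D = (R²_long -
R²_med) var(Y)` (`Extends.gammaTwoLong_sq`). Thus `cov(X, γ₂W₂) / var(γ₂W₂) = B v / (D + B² v)`, and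
clearing denominators in A2 yields the cubic `f₀ + δ f₁ = 0` (`Extends.assumptionA2_iff`). The
condition `γ₁ ≠ 0` excludes the exceptional set, while `γ₂ ≠ 0` is automatic from `D > 0`.

Conversely, every real `b` is attained if A2 and A3 are dropped (`exists_extends_betaLong_eq`):
solve the equations above for `γ₂`, `c`, `m` and realize these covariances by a suitable `W₂`
(`exists_extends`). Such a `W₂` exists because `D ≤ vε`, that is `R²_long ≤ 1`, and the long
regressors are nondegenerate because `D > 0`. A2 and A3 then hold exactly when `b` is in `B_I(δ,
R²_long)`. -/

namespace OVB

/-! ### Covariances of linear combinations and the normal equations -/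

section LinComb

variable {Ω ι : Type*} [Fintype ι]

theorem linComb_zero (z : ι → Ω → ℝ) : linComb 0 z = fun _ => 0 := by
  ext ω
  simp [linComb]

theorem linComb_add (c e : ι → ℝ) (z : ι → Ω → ℝ) (ω : Ω) :
    linComb (c + e) z ω = linComb c z ω + linComb e z ω := by
  simp [linComb, add_mul, Finset.sum_add_distrib]

theorem linComb_smul (t : ℝ) (c : ι → ℝ) (z : ι → Ω → ℝ) (ω : Ω) :
    linComb (t • c) z ω = t * linComb c z ω := by
  simp [linComb, Finset.mul_sum, mul_assoc]

end LinComb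

section General

variable {Ω ι : Type*} [MeasurableSpace Ω] [Fintype ι] {μ : Measure Ω} {z : ι → Ω → ℝ}

theorem memLp_linComb (hz : ∀ i, MemLp (z i) 2 μ) (c : ι → ℝ) : MemLp (linComb c z) 2 μ :=
  memLp_finsetSum _ fun i _ => (hz i).const_mul (c i)

theorem measurable_linComb (hz : ∀ i, Measurable (z i)) (c : ι → ℝ) :
    Measurable (linComb c z) :=
  Finset.measurable_fun_sum _ fun i _ => (hz i).const_mul (c i)

variable [IsProbabilityMeasure μ] {y : Ω → ℝ}

theorem cov_linComb_right (hz : ∀ i, MemLp (z i) 2 μ) (hy : MemLp y 2 μ) (c : ι → ℝ) :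
    cov[y, linComb c z; μ] = ∑ i, c i * cov[y, z i; μ] := by
  unfold linComb
  rw [covariance_fun_sum_right (fun i => (hz i).const_mul (c i)) hy]
  simp [covariance_const_mul_right]

theorem cov_linComb_left (hz : ∀ i, MemLp (z i) 2 μ) (hy : MemLp y 2 μ) (c : ι → ℝ) :
    cov[linComb c z, y; μ] = ∑ i, c i * cov[z i, y; μ] := by
  rw [covariance_comm, cov_linComb_right hz hy]
  simp [covariance_comm]

theorem cov_linComb_left_eq_zero (hz : ∀ i, MemLp (z i) 2 μ) (hy : MemLp y 2 μ) (c : ι → ℝ)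
    (h : ∀ i, cov[z i, y; μ] = 0) : cov[linComb c z, y; μ] = 0 := by
  simp [cov_linComb_left hz hy, h]

theorem varMatrix_mulVec (hz : ∀ i, MemLp (z i) 2 μ) (c : ι → ℝ) (i : ι) :
    (varMatrix μ z *ᵥ c) i = cov[z i, linComb c z; μ] := by
  rw [cov_linComb_right hz (hz i)]
  simp [varMatrix, mulVec, dotProduct, mul_comm]

/-- The quadratic form of the variance matrix at `c` is the variance of `c'z`, and symmetry is
automatic. -/
theorem posDef_varMatrix_iff (hz : ∀ i, MemLp (z i) 2 μ) :
    (varMatrix μ z).PosDef ↔ ∀ c : ι → ℝ, c ≠ 0 → 0 < Var[linComb c z; μ] := by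
  have key : ∀ c : ι → ℝ, star c ⬝ᵥ (varMatrix μ z *ᵥ c) = Var[linComb c z; μ] := by
    intro c
    have hc := memLp_linComb hz c
    rw [← covariance_self hc.aemeasurable, cov_linComb_left hz hc]
    simp [dotProduct, varMatrix_mulVec hz]
  rw [posDef_iff_dotProduct_mulVec]
  simp only [key]
  refine ⟨fun h c hc => h.2 hc, fun h => ⟨?_, fun c hc => h c hc⟩⟩
  ext i j
  simp [varMatrix, covariance_comm]

variable [DecidableEq ι]

/-- The normal equations characterize the regression coefficients. -/
theorem olsCoef_eq_iff (hz : ∀ i, MemLp (z i) 2 μ) (hy : MemLp y 2 μ)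
    (hpd : (varMatrix μ z).PosDef) (c : ι → ℝ) :
    olsCoef μ y z = c ↔ ∀ i, cov[z i, fun ω => y ω - linComb c z ω; μ] = 0 := by
  have hdet : IsUnit (varMatrix μ z).det := (Matrix.isUnit_iff_isUnit_det _).1 hpd.isUnit
  have h1 : olsCoef μ y z = c ↔ (fun i => cov[z i, y; μ]) = varMatrix μ z *ᵥ c := by
    unfold olsCoef
    constructor
    · rintro rfl
      rw [mulVec_mulVec, Matrix.mul_nonsing_inv _ hdet, one_mulVec]
    · intro h
      rw [h, mulVec_mulVec, Matrix.nonsing_inv_mul _ hdet, one_mulVec]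
  rw [h1, funext_iff]
  refine forall_congr' fun i => ?_
  rw [varMatrix_mulVec hz, covariance_fun_sub_right (hz i) hy (memLp_linComb hz c), sub_eq_zero]

theorem cov_ols_residual (hz : ∀ i, MemLp (z i) 2 μ) (hy : MemLp y 2 μ)
    (hpd : (varMatrix μ z).PosDef) (i : ι) :
    cov[z i, fun ω => y ω - linComb (olsCoef μ y z) z ω; μ] = 0 :=
  (olsCoef_eq_iff hz hy hpd _).1 rfl i

/-- The fitted value is uncorrelated with the residual, so the variance of `y` splits into the two.
-/
theorem rSquared_mul_variance (hz : ∀ i, MemLp (z i) 2 μ) (hy : MemLp y 2 μ)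
    (hpd : (varMatrix μ z).PosDef) (hvar : Var[y; μ] ≠ 0) :
    rSquared μ y z * Var[y; μ] =
      Var[y; μ] - Var[fun ω => y ω - linComb (olsCoef μ y z) z ω; μ] := by
  have hf := memLp_linComb hz (olsCoef μ y z)
  have h0 := cov_linComb_left_eq_zero hz (hy.sub hf) (olsCoef μ y z)
    (cov_ols_residual hz hy hpd)
  rw [rSquared, div_mul_cancel₀ _ hvar, variance_fun_sub hy hf]
  rw [covariance_sub_right hf hy hf, covariance_self hf.aemeasurable, covariance_comm] at h0
  linarith

end General

/-! ### The observed distribution -/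

section Observed

variable {d : ℕ} {P : Measure (Obs d)}

/-- The residual of the medium regression. -/
noncomputable def medResid (P : Measure (Obs d)) : Obs d → ℝ :=
  fun p => obsY p - linComb (olsCoef P obsY medRegressors) medRegressors p

theorem measurable_obsY : Measurable (obsY (d := d)) := measurable_fst

theorem measurable_obsX : Measurable (obsX (d := d)) := measurable_snd.fst

theorem measurable_obsW1 (j : Fin d) : Measurable (obsW1 (d := d) j) :=
  (measurable_pi_apply j).comp measurable_snd.snd

theorem measurable_xPerp : Measurable (xPerp P) :=
  measurable_obsX.sub (measurable_linComb measurable_obsW1 _)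

theorem medRegressors_linComb (c : Unit ⊕ Fin d → ℝ) (p : Obs d) :
    linComb c medRegressors p =
      c (Sum.inl ()) * obsX p + linComb (fun j => c (Sum.inr j)) obsW1 p := by
  simp [linComb, medRegressors]

theorem medResid_apply (p : Obs d) :
    medResid P p = obsY p - betaMed P * obsX p - linComb (gammaMed P) obsW1 p := by
  rw [medResid, medRegressors_linComb, ← sub_sub]
  rfl

theorem measurable_medResid : Measurable (medResid P) := by
  have : medResid P = fun p => obsY p - betaMed P * obsX p - linComb (gammaMed P) obsW1 p :=
    funext medResid_apply
  rw [this]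
  exact (measurable_obsY.sub (measurable_obsX.const_mul _)).sub
    (measurable_linComb measurable_obsW1 _)

theorem linComb_add_smul_eq (B : ℝ) (c e : Fin d → ℝ) :
    linComb (c + B • e) obsW1 = fun p => linComb c obsW1 p + B * linComb e obsW1 p := by
  ext p
  rw [linComb_add, linComb_smul]

namespace ObsRegular

theorem memLp_obsY (hP : ObsRegular P) : MemLp (obsY (d := d)) 2 P :=
  hP.finite_var (Sum.inl ())

theorem memLp_medRegressors (hP : ObsRegular P) (i : Unit ⊕ Fin d) :
    MemLp (medRegressors (d := d) i) 2 P :=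
  hP.finite_var (Sum.inr i)

theorem memLp_obsX (hP : ObsRegular P) : MemLp (obsX (d := d)) 2 P :=
  hP.finite_var (Sum.inr (Sum.inl ()))

theorem memLp_obsW1 (hP : ObsRegular P) (j : Fin d) : MemLp (obsW1 (d := d) j) 2 P :=
  hP.finite_var (Sum.inr (Sum.inr j))

theorem posDef_medRegressors (hP : ObsRegular P) :
    (varMatrix P (medRegressors (d := d))).PosDef :=
  hP.posDef.submatrix (e := Sum.inr) Sum.inr_injective

theorem posDef_obsW1 (hP : ObsRegular P) : (varMatrix P (obsW1 (d := d))).PosDef :=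
  hP.posDef_medRegressors.submatrix (e := Sum.inr) Sum.inr_injective

theorem memLp_xPerp (hP : ObsRegular P) : MemLp (xPerp P) 2 P :=
  hP.memLp_obsX.sub (memLp_linComb hP.memLp_obsW1 _)

theorem memLp_medResid (hP : ObsRegular P) : MemLp (medResid P) 2 P :=
  hP.memLp_obsY.sub (memLp_linComb hP.memLp_medRegressors _)

variable [IsProbabilityMeasure P]

theorem variance_obsY_pos (hP : ObsRegular P) : 0 < Var[obsY (d := d); P] := by
  have h := (posDef_varMatrix_iff hP.finite_var).1 hP.posDef (Sum.elim (fun _ => 1) 0)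
    (fun h => one_ne_zero (congrFun h (Sum.inl ())))
  have e : linComb (Sum.elim (fun _ => 1) 0) obsVector = obsY (d := d) := by
    ext p
    simp [linComb, obsVector]
  rwa [e] at h

theorem variance_xPerp_pos (hP : ObsRegular P) : 0 < Var[xPerp P; P] := by
  have h := (posDef_varMatrix_iff hP.memLp_medRegressors).1 hP.posDef_medRegressors
    (Sum.elim (fun _ => 1) (-piOne P)) (fun h => one_ne_zero (congrFun h (Sum.inl ())))
  have e : linComb (Sum.elim (fun _ => 1) (-piOne P)) medRegressors = xPerp P := by
    ext p
    simp [linComb, medRegressors, xPerp, sub_eq_add_neg]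
  rwa [e] at h

/-- The residual is a combination of `(Y, X, W₁)` with coefficient `1` on `Y`, hence a nonzero one.
Positivity permits dividing by this variance when `W₂` is constructed. -/
theorem variance_medResid_pos (hP : ObsRegular P) : 0 < Var[medResid P; P] := by
  have h := (posDef_varMatrix_iff hP.finite_var).1 hP.posDef
    (Sum.elim (fun _ => 1) (-olsCoef P obsY medRegressors))
    (fun h => one_ne_zero (congrFun h (Sum.inl ())))
  have e : linComb (Sum.elim (fun _ => 1) (-olsCoef P obsY medRegressors)) obsVector
      = medResid P := by
    ext p
    simp [linComb, obsVector, medResid, sub_eq_add_neg]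
  rwa [e] at h

theorem cov_obsW1_xPerp (hP : ObsRegular P) (j : Fin d) : cov[obsW1 j, xPerp P; P] = 0 :=
  cov_ols_residual hP.memLp_obsW1 hP.memLp_obsX hP.posDef_obsW1 j

theorem cov_medRegressors_medResid (hP : ObsRegular P) (i : Unit ⊕ Fin d) :
    cov[medRegressors i, medResid P; P] = 0 :=
  cov_ols_residual hP.memLp_medRegressors hP.memLp_obsY hP.posDef_medRegressors i

theorem cov_obsW1_medResid (hP : ObsRegular P) (j : Fin d) :
    cov[obsW1 j, medResid P; P] = 0 :=
  hP.cov_medRegressors_medResid (Sum.inr j)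

theorem cov_linComb_xPerp (hP : ObsRegular P) (c : Fin d → ℝ) :
    cov[linComb c obsW1, xPerp P; P] = 0 :=
  cov_linComb_left_eq_zero hP.memLp_obsW1 hP.memLp_xPerp c hP.cov_obsW1_xPerp

theorem cov_linComb_medResid (hP : ObsRegular P) (c : Fin d → ℝ) :
    cov[linComb c obsW1, medResid P; P] = 0 :=
  cov_linComb_left_eq_zero hP.memLp_obsW1 hP.memLp_medResid c hP.cov_obsW1_medResid

theorem cov_xPerp_medResid (hP : ObsRegular P) : cov[xPerp P, medResid P; P] = 0 := by
  have h : cov[obsX, medResid P; P] = 0 := hP.cov_medRegressors_medResid (Sum.inl ())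
  have h' := covariance_fun_sub_left hP.memLp_obsX
    (memLp_linComb hP.memLp_obsW1 (piOne P)) hP.memLp_medResid
  rw [h, hP.cov_linComb_medResid, sub_zero] at h'
  exact h'

/-- Only the projection of `X` on `W₁` matters for its covariance with a combination of `W₁`. -/
theorem cov_obsX_linComb (hP : ObsRegular P) (c : Fin d → ℝ) :
    cov[obsX, linComb c obsW1; P] = cov[linComb (piOne P) obsW1, linComb c obsW1; P] := by
  have hc := memLp_linComb hP.memLp_obsW1 c
  have h := covariance_fun_sub_left hP.memLp_obsX
    (memLp_linComb hP.memLp_obsW1 (piOne P)) hc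
  have h' : cov[xPerp P, linComb c obsW1; P] = 0 := by
    rw [covariance_comm, hP.cov_linComb_xPerp]
  have e : xPerp P = fun p => obsX p - linComb (piOne P) obsW1 p := rfl
  rw [← e, h'] at h
  linarith

theorem variance_medResid (hP : ObsRegular P) :
    Var[medResid P; P] = Var[obsY; P] - rSquaredMed P * Var[obsY; P] := by
  have h := rSquared_mul_variance hP.memLp_medRegressors hP.memLp_obsY hP.posDef_medRegressors
    hP.variance_obsY_pos.ne'
  have e : medResid P =
    fun p => obsY p - linComb (olsCoef P obsY medRegressors) medRegressors p := rfl
  rw [e, rSquaredMed]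
  linarith

theorem cov_obsX_index (hP : ObsRegular P) (B : ℝ) :
    cov[obsX, linComb (gammaMed P + B • piOne P) obsW1; P] =
      cov[obsX, linComb (gammaMed P) obsW1; P] + B * Var[linComb (piOne P) obsW1; P] := by
  have hγ := memLp_linComb hP.memLp_obsW1 (gammaMed P)
  have hπ := memLp_linComb hP.memLp_obsW1 (piOne P)
  have e := covariance_add_right hP.memLp_obsX hγ (hπ.const_mul B)
  rw [linComb_add_smul_eq]
  refine e.trans ?_
  rw [covariance_const_mul_right, hP.cov_obsX_linComb (piOne P), covariance_self hπ.aemeasurable]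

theorem variance_index (hP : ObsRegular P) (B : ℝ) :
    Var[linComb (gammaMed P + B • piOne P) obsW1; P] =
      Var[linComb (gammaMed P) obsW1; P] + 2 * B * cov[obsX, linComb (gammaMed P) obsW1; P]
        + B ^ 2 * Var[linComb (piOne P) obsW1; P] := by
  have hγ := memLp_linComb hP.memLp_obsW1 (gammaMed P)
  have hπ := memLp_linComb hP.memLp_obsW1 (piOne P)
  rw [linComb_add_smul_eq, variance_fun_add hγ (hπ.const_mul B), covariance_const_mul_right,
    variance_const_mul, hP.cov_obsX_linComb (gammaMed P), covariance_comm]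
  ring

/-- The defining equation of `B_I(δ, R²_long)` in terms of the long index of `W₁`. -/
theorem fZero_add_mul_fOne_eq_zero_iff (hP : ObsRegular P) (B δ R2 : ℝ) :
    fZero P B + δ * fOne P B R2 = 0 ↔
      B * Var[xPerp P; P] * Var[linComb (gammaMed P + B • piOne P) obsW1; P] =
        δ * (((R2 - rSquaredMed P) * Var[obsY; P] + B ^ 2 * Var[xPerp P; P]) *
          cov[obsX, linComb (gammaMed P + B • piOne P) obsW1; P]) := by
  -- The last factor of `f₀` is the variance of the long index, and `f₁` factors as `(D + B² v)`
  -- times the covariance of `X` with that index.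
  rw [hP.variance_index, hP.cov_obsX_index, fZero, fOne]
  constructor <;> intro h <;> linear_combination -h

end ObsRegular

end Observed

/-! ### Joint distributions with an exogenous, normalized unobserved covariate -/

section Joint

variable {d : ℕ} {P : Measure (Obs d)} {Q : Measure (Full d)}

/-- `Q` has the observed marginal `P`, and `W₂` has unit variance and is uncorrelated with `W₁`. -/
structure Extends (P : Measure (Obs d)) (Q : Measure (Full d)) : Prop where
  marginal : Q.map Prod.fst = P
  memLp_fullW2 : MemLp (fullW2 (d := d)) 2 Q
  cov_fullW1_fullW2 : ∀ j : Fin d, cov[fullW1 j, fullW2; Q] = 0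
  variance_fullW2 : Var[fullW2 (d := d); Q] = 1

/-- The combination `r X^{⊥W₁} + h' W₁ + t ε + s W₂`, with `ε` the residual of the medium
regression. -/
noncomputable def jointComb (P : Measure (Obs d)) (r : ℝ) (h : Fin d → ℝ) (t s : ℝ) :
    Full d → ℝ :=
  fun q => r * xPerp P q.1 + linComb h obsW1 q.1 + t * medResid P q.1 + s * fullW2 q

theorem longRegressors_linComb (a : Unit ⊕ (Fin d ⊕ Unit) → ℝ) (q : Full d) :
    linComb a longRegressors q = a (Sum.inl ()) * obsX q.1
      + linComb (fun j => a (Sum.inr (Sum.inl j))) obsW1 q.1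
      + a (Sum.inr (Sum.inr ())) * fullW2 q := by
  simp [linComb, longRegressors, fullX, fullW1, add_assoc]

theorem linComb_longRegressors_eq_jointComb (P : Measure (Obs d))
    (a : Unit ⊕ (Fin d ⊕ Unit) → ℝ) :
    linComb a longRegressors = jointComb P (a (Sum.inl ()))
      ((fun j => a (Sum.inr (Sum.inl j))) + a (Sum.inl ()) • piOne P) 0
      (a (Sum.inr (Sum.inr ()))) := by
  ext q
  rw [longRegressors_linComb, jointComb, linComb_add, linComb_smul, xPerp]
  ring

/-- Puts the residual of any candidate coefficient vector in the orthogonal coordinates. Its `W₁`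
part is zero exactly when the candidate satisfies `γ₁ = γ_med + B π₁`. -/
theorem fullY_sub_linComb_eq_jointComb (P : Measure (Obs d))
    (a : Unit ⊕ (Fin d ⊕ Unit) → ℝ) :
    (fun q => fullY q - linComb a longRegressors q) = jointComb P (betaMed P - a (Sum.inl ()))
      (gammaMed P + (betaMed P - a (Sum.inl ())) • piOne P
        + (-1 : ℝ) • fun j => a (Sum.inr (Sum.inl j))) 1 (-a (Sum.inr (Sum.inr ()))) := by
  ext q
  rw [longRegressors_linComb, jointComb, linComb_add, linComb_add, linComb_smul, linComb_smul,
    xPerp, medResid_apply, fullY]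
  ring

namespace Extends

theorem memLp_comp_fst (hQ : Extends P Q) {f : Obs d → ℝ} (hf : MemLp f 2 P) :
    MemLp (fun q : Full d => f q.1) 2 Q := by
  have h := hQ.marginal
  subst h
  exact hf.comp_of_map measurable_fst.aemeasurable

theorem cov_comp_fst (hQ : Extends P Q) {f g : Obs d → ℝ} (hf : MemLp f 2 P)
    (hg : MemLp g 2 P) : cov[fun q : Full d => f q.1, fun q => g q.1; Q] = cov[f, g; P] := by
  have h := hQ.marginal
  subst h
  exact (covariance_map_fun hf.1 hg.1 measurable_fst.aemeasurable).symm

theorem variance_comp_fst (hQ : Extends P Q) {f : Obs d → ℝ} (hf : MemLp f 2 P) :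
    Var[fun q : Full d => f q.1; Q] = Var[f; P] := by
  rw [← covariance_self (hQ.memLp_comp_fst hf).aemeasurable, hQ.cov_comp_fst hf hf,
    covariance_self hf.aemeasurable]

theorem memLp_longRegressors (hQ : Extends P Q) (hP : ObsRegular P)
    (i : Unit ⊕ (Fin d ⊕ Unit)) : MemLp (longRegressors (d := d) i) 2 Q := by
  rcases i with _ | j | _
  · exact hQ.memLp_comp_fst hP.memLp_obsX
  · exact hQ.memLp_comp_fst (hP.memLp_obsW1 j)
  · exact hQ.memLp_fullW2

theorem memLp_jointComb (hQ : Extends P Q) (hP : ObsRegular P) (r : ℝ) (h : Fin d → ℝ)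
    (t s : ℝ) : MemLp (jointComb P r h t s) 2 Q :=
  ((((hQ.memLp_comp_fst hP.memLp_xPerp).const_mul r).add
    (hQ.memLp_comp_fst (memLp_linComb hP.memLp_obsW1 h))).add
    ((hQ.memLp_comp_fst hP.memLp_medResid).const_mul t)).add (hQ.memLp_fullW2.const_mul s)

variable [IsProbabilityMeasure Q]

theorem cov_jointComb (hQ : Extends P Q) (hP : ObsRegular P) {f : Full d → ℝ}
    (hf : MemLp f 2 Q) (r : ℝ) (h : Fin d → ℝ) (t s : ℝ) :
    cov[f, jointComb P r h t s; Q] = r * cov[f, fun q => xPerp P q.1; Q]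
      + cov[f, fun q => linComb h obsW1 q.1; Q] + t * cov[f, fun q => medResid P q.1; Q]
      + s * cov[f, fullW2; Q] := by
  have h1 := (hQ.memLp_comp_fst hP.memLp_xPerp).const_mul r
  have h2 := hQ.memLp_comp_fst (memLp_linComb hP.memLp_obsW1 h)
  have h3 := (hQ.memLp_comp_fst hP.memLp_medResid).const_mul t
  have h4 := hQ.memLp_fullW2.const_mul s
  rw [← covariance_const_mul_right, ← covariance_const_mul_right, ← covariance_const_mul_right,
    ← covariance_add_right hf h1 h2, ← covariance_add_right hf (h1.add h2) h3,
    ← covariance_add_right hf ((h1.add h2).add h3) h4]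
  rfl

theorem cov_linComb_fullW2 (hQ : Extends P Q) (hP : ObsRegular P) (h : Fin d → ℝ) :
    cov[fun q => linComb h obsW1 q.1, fullW2; Q] = 0 :=
  cov_linComb_left_eq_zero (z := fullW1) (fun j => hQ.memLp_comp_fst (hP.memLp_obsW1 j))
    hQ.memLp_fullW2 h hQ.cov_fullW1_fullW2

/-- The part `π₁'W₁` of `X` is uncorrelated with `W₂`. -/
theorem cov_fullX_fullW2 (hQ : Extends P Q) (hP : ObsRegular P) :
    cov[fullX, fullW2; Q] = cov[fun q => xPerp P q.1, fullW2; Q] := by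
  have h := covariance_fun_sub_left (hQ.memLp_comp_fst hP.memLp_obsX)
    (hQ.memLp_comp_fst (memLp_linComb hP.memLp_obsW1 (piOne P))) hQ.memLp_fullW2
  rw [hQ.cov_linComb_fullW2 hP, sub_zero] at h
  exact h.symm

theorem cov_fullW2_jointComb (hQ : Extends P Q) (hP : ObsRegular P) (r : ℝ)
    (h : Fin d → ℝ) (t s : ℝ) :
    cov[fullW2, jointComb P r h t s; Q] = r * cov[fun q => xPerp P q.1, fullW2; Q]
      + t * cov[fun q => medResid P q.1, fullW2; Q] + s := by
  rw [hQ.cov_jointComb hP hQ.memLp_fullW2, covariance_self hQ.memLp_fullW2.aemeasurable,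
    hQ.variance_fullW2, covariance_comm fullW2 fun q => linComb h obsW1 q.1,
    hQ.cov_linComb_fullW2 hP, covariance_comm fullW2 fun q => xPerp P q.1,
    covariance_comm fullW2 fun q => medResid P q.1]
  ring

variable [IsProbabilityMeasure P]

/-- All other components are uncorrelated with `W₁`, so the normal equations for `W₁` constrain `h`
alone. -/
theorem cov_linComb_jointComb (hQ : Extends P Q) (hP : ObsRegular P) (c : Fin d → ℝ) (r : ℝ)
    (h : Fin d → ℝ) (t s : ℝ) :
    cov[fun q => linComb c obsW1 q.1, jointComb P r h t s; Q] =
      cov[linComb c obsW1, linComb h obsW1; P] := by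
  have hc := memLp_linComb hP.memLp_obsW1 c
  rw [hQ.cov_jointComb hP (hQ.memLp_comp_fst hc), hQ.cov_comp_fst hc hP.memLp_xPerp,
    hQ.cov_comp_fst hc (memLp_linComb hP.memLp_obsW1 h), hQ.cov_comp_fst hc hP.memLp_medResid,
    hQ.cov_linComb_fullW2 hP, hP.cov_linComb_xPerp, hP.cov_linComb_medResid]
  ring

theorem cov_fullW1_jointComb (hQ : Extends P Q) (hP : ObsRegular P) (j : Fin d) (r : ℝ)
    (h : Fin d → ℝ) (t s : ℝ) :
    cov[fullW1 j, jointComb P r h t s; Q] = cov[obsW1 j, linComb h obsW1; P] := by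
  have e : ∀ p : Obs d, linComb (Pi.single j 1) obsW1 p = obsW1 j p := by
    intro p
    simp [linComb, Pi.single_apply]
  have h := hQ.cov_linComb_jointComb hP (Pi.single j 1) r h t s
  rwa [funext e] at h

theorem cov_xPerp_jointComb (hQ : Extends P Q) (hP : ObsRegular P) (r : ℝ)
    (h : Fin d → ℝ) (t s : ℝ) :
    cov[fun q => xPerp P q.1, jointComb P r h t s; Q] =
      r * Var[xPerp P; P] + s * cov[fun q => xPerp P q.1, fullW2; Q] := by
  have hx := hP.memLp_xPerp
  rw [hQ.cov_jointComb hP (hQ.memLp_comp_fst hx), hQ.cov_comp_fst hx hx,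
    hQ.cov_comp_fst hx (memLp_linComb hP.memLp_obsW1 h), hQ.cov_comp_fst hx hP.memLp_medResid,
    covariance_self hx.aemeasurable, covariance_comm (xPerp P) (linComb h obsW1),
    hP.cov_linComb_xPerp, hP.cov_xPerp_medResid]
  ring

theorem cov_medResid_jointComb (hQ : Extends P Q) (hP : ObsRegular P) (r : ℝ)
    (h : Fin d → ℝ) (t s : ℝ) :
    cov[fun q => medResid P q.1, jointComb P r h t s; Q] =
      t * Var[medResid P; P] + s * cov[fun q => medResid P q.1, fullW2; Q] := by
  have hx := hP.memLp_medResid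
  rw [hQ.cov_jointComb hP (hQ.memLp_comp_fst hx), hQ.cov_comp_fst hx hx,
    hQ.cov_comp_fst hx (memLp_linComb hP.memLp_obsW1 h), hQ.cov_comp_fst hx hP.memLp_xPerp,
    covariance_self hx.aemeasurable, covariance_comm (medResid P) (linComb h obsW1),
    covariance_comm (medResid P) (xPerp P), hP.cov_linComb_medResid, hP.cov_xPerp_medResid]
  ring

theorem variance_jointComb (hQ : Extends P Q) (hP : ObsRegular P) (r : ℝ)
    (h : Fin d → ℝ) (t s : ℝ) :
    Var[jointComb P r h t s; Q] = r ^ 2 * Var[xPerp P; P] + Var[linComb h obsW1; P]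
      + t ^ 2 * Var[medResid P; P] + s ^ 2
      + 2 * s * (r * cov[fun q => xPerp P q.1, fullW2; Q]
        + t * cov[fun q => medResid P q.1, fullW2; Q]) := by
  have hj := hQ.memLp_jointComb hP r h t s
  have hh := memLp_linComb hP.memLp_obsW1 h
  rw [← covariance_self hj.aemeasurable, hQ.cov_jointComb hP hj, covariance_comm,
    hQ.cov_xPerp_jointComb hP, covariance_comm (jointComb P r h t s) fun q => linComb h obsW1 q.1,
    hQ.cov_linComb_jointComb hP, covariance_self hh.aemeasurable,
    covariance_comm (jointComb P r h t s) fun q => medResid P q.1,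
    hQ.cov_medResid_jointComb hP,
    covariance_comm (jointComb P r h t s) fullW2, hQ.cov_fullW2_jointComb hP]
  ring

/-- Nondegeneracy of the long regressors, given that `cov(X, W₂)² < var(X^{⊥W₁})`. -/
theorem posDef_longRegressors (hQ : Extends P Q) (hP : ObsRegular P)
    (hc : cov[fun q => xPerp P q.1, fullW2; Q] ^ 2 < Var[xPerp P; P]) :
    (varMatrix Q (longRegressors (d := d))).PosDef := by
  rw [posDef_varMatrix_iff (hQ.memLp_longRegressors hP)]
  intro a ha
  rw [linComb_longRegressors_eq_jointComb P, hQ.variance_jointComb hP]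
  set c := cov[fun q => xPerp P q.1, fullW2; Q]
  set h : Fin d → ℝ := (fun j => a (Sum.inr (Sum.inl j))) + a (Sum.inl ()) • piOne P with hh
  set r := a (Sum.inl ()) with hr
  set s := a (Sum.inr (Sum.inr ())) with hs
  have hnn : 0 ≤ Var[linComb h obsW1; P] := variance_nonneg _ _
  -- Completing the square in `s` leaves `v - c²` as the coefficient of `r²`, which is where the
  -- bound on `c` enters.
  have key : r ^ 2 * Var[xPerp P; P] + Var[linComb h obsW1; P] + 0 ^ 2 * Var[medResid P; P]
      + s ^ 2 + 2 * s * (r * c + 0 * cov[fun q => medResid P q.1, fullW2; Q]) =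
      r ^ 2 * (Var[xPerp P; P] - c ^ 2) + (s + r * c) ^ 2 + Var[linComb h obsW1; P] := by ring
  rw [key]
  by_cases hr0 : r = 0
  · by_cases hs0 : s = 0
    · have hne : h ≠ 0 := by
        intro h0
        apply ha
        ext i
        rcases i with _ | j | _
        · exact hr0
        · have := congrFun h0 j
          simpa [hh, hr0] using this
        · exact hs0
      have := (posDef_varMatrix_iff hP.memLp_obsW1).1 hP.posDef_obsW1 h hne
      simpa [hr0, hs0] using this
    · have : 0 < s ^ 2 := by positivity
      rw [hr0]
      nlinarith
  · have : 0 < r ^ 2 * (Var[xPerp P; P] - c ^ 2) := mul_pos (by positivity) (sub_pos.2 hc)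
    nlinarith [sq_nonneg (s + r * c)]

/-- The coefficients of the long regression in terms of the medium regression and the covariances
of `W₂` with `X^{⊥W₁}` and with the residual of the medium regression. -/
theorem olsCoef_long_iff (hQ : Extends P Q) (hP : ObsRegular P)
    (hpd : (varMatrix Q (longRegressors (d := d))).PosDef) (a : Unit ⊕ (Fin d ⊕ Unit) → ℝ) :
    olsCoef Q fullY longRegressors = a ↔
      (fun j => a (Sum.inr (Sum.inl j))) =
          gammaMed P + (betaMed P - a (Sum.inl ())) • piOne P ∧
        (betaMed P - a (Sum.inl ())) * Var[xPerp P; P] =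
          a (Sum.inr (Sum.inr ())) * cov[fun q => xPerp P q.1, fullW2; Q] ∧
        a (Sum.inr (Sum.inr ())) =
          (betaMed P - a (Sum.inl ())) * cov[fun q => xPerp P q.1, fullW2; Q]
            + cov[fun q => medResid P q.1, fullW2; Q] := by
  have hY : MemLp (fullY (d := d)) 2 Q := hQ.memLp_comp_fst hP.memLp_obsY
  rw [olsCoef_eq_iff (hQ.memLp_longRegressors hP) hY hpd, fullY_sub_linComb_eq_jointComb P]
  set B := betaMed P - a (Sum.inl ())
  set s := a (Sum.inr (Sum.inr ()))
  set g : Fin d → ℝ := fun j => a (Sum.inr (Sum.inl j)) with hg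
  set h := gammaMed P + B • piOne P + (-1 : ℝ) • g with hh
  have hjm := hQ.memLp_jointComb hP B h 1 (-s)
  -- Split `X = X^{⊥W₁} + π₁'W₁`. The second covariance vanishes once `h = 0`.
  have hX : cov[fullX, jointComb P B h 1 (-s); Q] =
      cov[fun q => xPerp P q.1, jointComb P B h 1 (-s); Q]
        + cov[linComb (piOne P) obsW1, linComb h obsW1; P] := by
    rw [← hQ.cov_linComb_jointComb hP (piOne P) B h 1 (-s),
      ← covariance_add_left (hQ.memLp_comp_fst hP.memLp_xPerp)
        (hQ.memLp_comp_fst (memLp_linComb hP.memLp_obsW1 (piOne P))) hjm]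
    congr 1
    ext q
    simp [fullX, xPerp]
  -- If `h'W₁` is uncorrelated with each component of `W₁`, it is uncorrelated with itself, so
  -- positive definiteness forces `h = 0`.
  have hW : (∀ j, cov[fullW1 j, jointComb P B h 1 (-s); Q] = 0) ↔ h = 0 := by
    simp only [hQ.cov_fullW1_jointComb hP]
    constructor
    · intro h0
      by_contra hne
      have hpos := (posDef_varMatrix_iff hP.memLp_obsW1).1 hP.posDef_obsW1 h hne
      have hm := memLp_linComb hP.memLp_obsW1 h
      rw [← covariance_self hm.aemeasurable,
        cov_linComb_left_eq_zero hP.memLp_obsW1 hm h h0] at hpos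
      exact lt_irrefl _ hpos
    · intro h0 j
      rw [h0, linComb_zero, covariance_const_right]
  have hh0 : h = 0 ↔ g = gammaMed P + B • piOne P := by
    rw [hh, neg_one_smul, ← sub_eq_add_neg, sub_eq_zero, eq_comm]
  have e : (∀ i, cov[longRegressors i, jointComb P B h 1 (-s); Q] = 0) ↔
      cov[fullX, jointComb P B h 1 (-s); Q] = 0 ∧
        (∀ j, cov[fullW1 j, jointComb P B h 1 (-s); Q] = 0) ∧
        cov[fullW2, jointComb P B h 1 (-s); Q] = 0 := by
    simp [Sum.forall, longRegressors]
  rw [e, hW, hX, hQ.cov_xPerp_jointComb hP, hQ.cov_fullW2_jointComb hP, ← hh0]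
  constructor
  · rintro ⟨h1, h2, h3⟩
    rw [h2, linComb_zero, covariance_const_right] at h1
    exact ⟨h2, by linarith, by linarith⟩
  · rintro ⟨h2, h1, h3⟩
    rw [h2, linComb_zero, covariance_const_right]
    exact ⟨by linarith, rfl, by linarith⟩

/-- The variance explained by `W₂` beyond the medium regression. -/
theorem gammaTwoLong_sq (hQ : Extends P Q) (hP : ObsRegular P)
    (hpd : (varMatrix Q (longRegressors (d := d))).PosDef) :
    gammaTwoLong Q ^ 2 = (rSquaredLong Q - rSquaredMed P) * Var[obsY; P]
      + (betaMed P - betaLong Q) ^ 2 * Var[xPerp P; P] := by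
  have hY : MemLp (fullY (d := d)) 2 Q := hQ.memLp_comp_fst hP.memLp_obsY
  have hvY : Var[fullY (d := d); Q] = Var[obsY; P] := hQ.variance_comp_fst hP.memLp_obsY
  have hR := rSquared_mul_variance (hQ.memLp_longRegressors hP) hY hpd
    (hvY ▸ hP.variance_obsY_pos.ne')
  obtain ⟨h1, h2, h3⟩ := (hQ.olsCoef_long_iff hP hpd _).1 rfl
  rw [fullY_sub_linComb_eq_jointComb P, hQ.variance_jointComb hP, hvY, h1, neg_one_smul,
    add_neg_cancel, linComb_zero, ← Pi.zero_def, variance_zero, hP.variance_medResid] at hR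
  simp only [rSquaredLong, gammaTwoLong, betaLong]
  set g := olsCoef Q fullY longRegressors (Sum.inr (Sum.inr ()))
  set B := betaMed P - olsCoef Q fullY longRegressors (Sum.inl ())
  -- The residual variance is `B² v + vε + g² - 2g(Bc + m)`, and `h3` replaces `Bc + m` by `g`.
  linear_combination -hR + 2 * g * h3

end Extends

end Joint

/-! ### The identified sets -/

section Identification

variable {d : ℕ} {P : Measure (Obs d)}

theorem Compatible.extends {δ R2 : ℝ} {Q : Measure (Full d)} (h : Compatible P δ R2 Q) :
    Extends P Q :=
  ⟨h.marginal, h.a1.finite_var_long (Sum.inr (Sum.inr ())), h.a4, h.a5⟩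

namespace Extends

variable {Q : Measure (Full d)}

theorem cov_fullX_indexOne (hQ : Extends P Q) (hP : ObsRegular P) :
    cov[fullX, indexOne Q; Q] = cov[obsX, linComb (gammaOneLong Q) obsW1; P] :=
  hQ.cov_comp_fst hP.memLp_obsX (memLp_linComb hP.memLp_obsW1 (gammaOneLong Q))

theorem variance_indexOne (hQ : Extends P Q) (hP : ObsRegular P) :
    Var[indexOne Q; Q] = Var[linComb (gammaOneLong Q) obsW1; P] := by
  have e : indexOne Q = fun q => linComb (gammaOneLong Q) obsW1 q.1 := rfl
  rw [e, hQ.variance_comp_fst (memLp_linComb hP.memLp_obsW1 (gammaOneLong Q))]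

theorem variance_indexTwo (hQ : Extends P Q) : Var[indexTwo Q; Q] = gammaTwoLong Q ^ 2 := by
  unfold indexTwo
  rw [variance_const_mul, hQ.variance_fullW2, mul_one]

variable [IsProbabilityMeasure P] [IsProbabilityMeasure Q]

theorem gammaOneLong_eq (hQ : Extends P Q) (hP : ObsRegular P)
    (hpd : (varMatrix Q (longRegressors (d := d))).PosDef) :
    gammaOneLong Q = gammaMed P + (betaMed P - betaLong Q) • piOne P :=
  ((hQ.olsCoef_long_iff hP hpd _).1 rfl).1

theorem gammaTwoLong_mul_cov (hQ : Extends P Q) (hP : ObsRegular P)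
    (hpd : (varMatrix Q (longRegressors (d := d))).PosDef) :
    gammaTwoLong Q * cov[fun q => xPerp P q.1, fullW2; Q] =
      (betaMed P - betaLong Q) * Var[xPerp P; P] :=
  ((hQ.olsCoef_long_iff hP hpd _).1 rfl).2.1.symm

/-- A strict gain in R-squared makes `γ₂²` positive, so this half of A3 imposes nothing further. -/
theorem gammaTwoLong_ne_zero (hQ : Extends P Q) (hP : ObsRegular P)
    (hpd : (varMatrix Q (longRegressors (d := d))).PosDef)
    (hR : rSquaredMed P < rSquaredLong Q) : gammaTwoLong Q ≠ 0 := by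
  have h1 : 0 < (rSquaredLong Q - rSquaredMed P) * Var[obsY; P] :=
    mul_pos (sub_pos.2 hR) hP.variance_obsY_pos
  have h2 := mul_nonneg (sq_nonneg (betaMed P - betaLong Q)) hP.variance_xPerp_pos.le
  rw [← sq_pos_iff, hQ.gammaTwoLong_sq hP hpd]
  linarith

theorem cov_fullX_indexTwo (hQ : Extends P Q) (hP : ObsRegular P)
    (hpd : (varMatrix Q (longRegressors (d := d))).PosDef) :
    cov[fullX, indexTwo Q; Q] = (betaMed P - betaLong Q) * Var[xPerp P; P] := by
  unfold indexTwo
  rw [covariance_const_mul_right, hQ.cov_fullX_fullW2 hP, hQ.gammaTwoLong_mul_cov hP hpd]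

/-- The proportional selection assumption is the cubic equation defining `B_I(δ, R²_long)`. -/
theorem assumptionA2_iff (hQ : Extends P Q) (hP : ObsRegular P)
    (hpd : (varMatrix Q (longRegressors (d := d))).PosDef) (h3 : AssumptionA3 Q) (δ : ℝ) :
    AssumptionA2 Q δ ↔ fZero P (betaMed P - betaLong Q)
      + δ * fOne P (betaMed P - betaLong Q) (rSquaredLong Q) = 0 := by
  have hv : Var[linComb (gammaOneLong Q) obsW1; P] ≠ 0 :=
    ((posDef_varMatrix_iff hP.memLp_obsW1).1 hP.posDef_obsW1 _ h3.1).ne'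
  have hg := pow_ne_zero 2 h3.2
  -- A3 makes both denominators of A2 nonzero, so cross-multiplication is an equivalence.
  rw [hP.fZero_add_mul_fOne_eq_zero_iff, ← hQ.gammaOneLong_eq hP hpd,
    ← hQ.gammaTwoLong_sq hP hpd, AssumptionA2, hQ.cov_fullX_indexOne hP,
    hQ.variance_indexOne hP, hQ.cov_fullX_indexTwo hP hpd, hQ.variance_indexTwo, mul_div_assoc',
    div_eq_div_iff hv hg]
  constructor <;> intro h <;> linear_combination -h

end Extends

/-! ### Attaining prescribed values by constructing `W₂` -/

variable [IsProbabilityMeasure P]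

/-- An extension of `P` by a linear combination of `X^{⊥W₁}`, the residual of the medium regression
and independent noise attains all covariances that are consistent with a unit variance. -/
theorem exists_extends (hP : ObsRegular P) (c m : ℝ)
    (h : c ^ 2 / Var[xPerp P; P] + m ^ 2 / Var[medResid P; P] ≤ 1) :
    ∃ Q : Measure (Full d), IsProbabilityMeasure Q ∧ Extends P Q ∧
      cov[fun q => xPerp P q.1, fullW2; Q] = c ∧
      cov[fun q => medResid P q.1, fullW2; Q] = m := by
  have hv := hP.variance_xPerp_pos
  have hvε := hP.variance_medResid_pos
  set v := Var[xPerp P; P] with hv_def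
  set vε := Var[medResid P; P] with hvε_def
  -- The noise supplies whatever variance the projection of `W₂` on `X^{⊥W₁}` and `ε` leaves short
  -- of `1`.
  set s := √(1 - (c ^ 2 / v + m ^ 2 / vε)) with hs_def
  have hs : s ^ 2 = 1 - (c ^ 2 / v + m ^ 2 / vε) := Real.sq_sqrt (by linarith)
  let ℓ : Obs d → ℝ := fun p => c / v * xPerp P p + m / vε * medResid P p
  have hℓ1 := hP.memLp_xPerp.const_mul (c / v)
  have hℓ2 := hP.memLp_medResid.const_mul (m / vε)
  have hℓ : MemLp ℓ 2 P := hℓ1.add hℓ2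
  have hℓ_meas : Measurable ℓ :=
    (measurable_xPerp.const_mul _).add (measurable_medResid.const_mul _)
  -- Only unit variance matters here; independence of the observed vector comes from the product
  -- measure.
  let ν := gaussianReal 0 1
  have hN : MemLp (fun x : ℝ => s * x) 2 ν :=
    (memLp_id_gaussianReal' 2 (by norm_num)).const_mul s
  let T : Obs d × ℝ → Full d := fun ω => (ω.1, ℓ ω.1 + s * ω.2)
  have hT : Measurable T :=
    measurable_fst.prodMk ((hℓ_meas.comp measurable_fst).add (measurable_snd.const_mul s))
  have hcov : ∀ f g : Obs d → ℝ, MemLp f 2 P → MemLp g 2 P →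
      cov[fun ω : Obs d × ℝ => f ω.1, fun ω => g ω.1; P.prod ν] = cov[f, g; P] := by
    intro f g hf hg
    have hfst : (P.prod ν).map Prod.fst = P := measurePreserving_fst.map_eq
    have h := covariance_map_fun (μ := P.prod ν) (Z := Prod.fst) (X := f) (Y := g)
      (by rw [hfst]; exact hf.1) (by rw [hfst]; exact hg.1) measurable_fst.aemeasurable
    rw [hfst] at h
    exact h.symm
  have hW : ∀ f : Obs d → ℝ, Measurable f → MemLp f 2 P →
      cov[fun q : Full d => f q.1, fullW2; (P.prod ν).map T] = cov[f, ℓ; P] := by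
    intro f hfm hf
    refine (covariance_map_fun (hfm.comp measurable_fst).aestronglyMeasurable
      measurable_snd.aestronglyMeasurable hT.aemeasurable).trans ?_
    refine (covariance_add_right (hf.comp_fst ν) (hℓ.comp_fst ν) (hN.comp_snd P)).trans ?_
    rw [hcov f ℓ hf hℓ, covariance_fst_snd_prod hf hN, add_zero]
  have hcovℓ : ∀ f : Obs d → ℝ, MemLp f 2 P →
      cov[f, ℓ; P] = c / v * cov[f, xPerp P; P] + m / vε * cov[f, medResid P; P] := by
    intro f hf
    rw [← covariance_const_mul_right, ← covariance_const_mul_right]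
    exact covariance_add_right hf hℓ1 hℓ2
  have hxℓ : cov[xPerp P, ℓ; P] = c := by
    rw [hcovℓ _ hP.memLp_xPerp, covariance_self hP.memLp_xPerp.aemeasurable,
      hP.cov_xPerp_medResid, ← hv_def]
    field_simp
    ring
  have hεℓ : cov[medResid P, ℓ; P] = m := by
    rw [hcovℓ _ hP.memLp_medResid, covariance_self hP.memLp_medResid.aemeasurable,
      covariance_comm, hP.cov_xPerp_medResid, ← hvε_def]
    field_simp
    ring
  have hvarℓ : Var[ℓ; P] = c ^ 2 / v + m ^ 2 / vε := by
    rw [← covariance_self hℓ.aemeasurable, hcovℓ _ hℓ, covariance_comm, hxℓ, covariance_comm, hεℓ]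
    ring
  have hvarN : Var[fun x : ℝ => s * x; ν] = s ^ 2 := by
    rw [variance_const_mul, variance_fun_id_gaussianReal]
    simp
  have hmem : MemLp (fun ω : Obs d × ℝ => ℓ ω.1 + s * ω.2) 2 (P.prod ν) :=
    (hℓ.comp_fst ν).add (hN.comp_snd P)
  refine ⟨(P.prod ν).map T, Measure.isProbabilityMeasure_map hT.aemeasurable, ⟨?_, ?_, ?_, ?_⟩,
    ?_, ?_⟩
  · rw [Measure.map_map measurable_fst hT]
    exact measurePreserving_fst.map_eq
  · exact (memLp_map_measure_iff measurable_snd.aestronglyMeasurable hT.aemeasurable).2 hmem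
  · intro j
    refine (hW _ (measurable_obsW1 j) (hP.memLp_obsW1 j)).trans ?_
    rw [hcovℓ _ (hP.memLp_obsW1 j), hP.cov_obsW1_xPerp, hP.cov_obsW1_medResid]
    ring
  · refine (variance_map measurable_snd.aemeasurable hT.aemeasurable).trans ?_
    have h1 := variance_fun_add (hℓ.comp_fst ν) (hN.comp_snd P)
    rw [covariance_fst_snd_prod hℓ hN,
      measurePreserving_fst.variance_fun_comp hℓ.aemeasurable,
      measurePreserving_snd.variance_fun_comp hN.aemeasurable, hvarℓ, hvarN, hs] at h1
    refine Eq.trans h1 ?_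
    ring
  · rw [hW _ measurable_xPerp hP.memLp_xPerp, hxℓ]
  · rw [hW _ measurable_medResid hP.memLp_medResid, hεℓ]

/-- Without the proportional selection assumption, every value of `β_long` is attained. -/
theorem exists_extends_betaLong_eq (hP : ObsRegular P) {R2 : ℝ}
    (hR2 : R2 ∈ Set.Ioc (rSquaredMed P) 1) (b : ℝ) :
    ∃ Q : Measure (Full d), IsProbabilityMeasure Q ∧ Extends P Q ∧
      (varMatrix Q (longRegressors (d := d))).PosDef ∧ betaLong Q = b ∧ rSquaredLong Q = R2 := by
  have hvY := hP.variance_obsY_pos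
  have hv := hP.variance_xPerp_pos
  have hvε := hP.variance_medResid_pos
  have hvε_eq := hP.variance_medResid
  set v := Var[xPerp P; P] with hv_def
  set vε := Var[medResid P; P]
  set B := betaMed P - b with hB
  set D := (R2 - rSquaredMed P) * Var[obsY; P] with hD_def
  have hD : 0 < D := mul_pos (sub_pos.2 hR2.1) hvY
  have hDε : D ≤ vε := by
    have := mul_le_mul_of_nonneg_right hR2.2 hvY.le
    rw [hvε_eq, hD_def]
    linarith
  have hBv : 0 ≤ B ^ 2 * v := by positivity
  -- The forced value of `γ₂`, up to sign. The normal equations then give `c = B v / g` and `m = g -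
  -- B c = D / g`.
  set g := √(D + B ^ 2 * v) with hg_def
  have hg : 0 < g := Real.sqrt_pos.2 (by linarith)
  have hg2 : g ^ 2 = D + B ^ 2 * v := Real.sq_sqrt (by linarith)
  have hle : (B * v / g) ^ 2 / v + (D / g) ^ 2 / vε ≤ 1 := by
    have e : (B * v / g) ^ 2 / v + (D / g) ^ 2 / vε = (B ^ 2 * v + D * (D / vε)) / g ^ 2 := by
      field_simp
    -- Here `R²_long ≤ 1` is used, in the form `D ≤ vε`.
    have h1 : D * (D / vε) ≤ D * 1 :=
      mul_le_mul_of_nonneg_left ((div_le_one hvε).2 hDε) hD.le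
    rw [e, div_le_one (by positivity), hg2]
    linarith
  obtain ⟨Q, hprob, hQ, hc, hm⟩ := exists_extends hP (B * v / g) (D / g) hle
  have hpd : (varMatrix Q (longRegressors (d := d))).PosDef := by
    refine hQ.posDef_longRegressors hP ?_
    -- The inequality `c² < v` amounts to `B² v < D + B² v`, so it is strict because `D > 0`.
    rw [hc, ← hv_def, div_pow, div_lt_iff₀ (by positivity), hg2]
    nlinarith [mul_pos hv hD]
  have hcoef := (hQ.olsCoef_long_iff hP hpd
    (Sum.elim (fun _ => b) (Sum.elim (gammaMed P + B • piOne P) fun _ => g))).2 (by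
      refine ⟨rfl, ?_, ?_⟩
      · simp only [Sum.elim_inl, Sum.elim_inr, hc, ← hB, ← hv_def]
        field_simp
      · simp only [Sum.elim_inl, Sum.elim_inr, hc, hm, ← hB]
        field_simp
        linarith)
  have hb : betaLong Q = b := by rw [betaLong, hcoef]; rfl
  have hg' : gammaTwoLong Q = g := by rw [gammaTwoLong, hcoef]; rfl
  refine ⟨Q, hprob, hQ, hpd, hb, ?_⟩
  have h := hQ.gammaTwoLong_sq hP hpd
  rw [hg', hb, hg2, ← hB, ← hv_def, hD_def] at h
  have h' := mul_right_cancel₀ hvY.ne' (add_right_cancel h)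
  linarith

/-- The identification result at a fixed `δ`. The union over `δ` follows by exchanging existential
quantifiers, and A6 only intersects with an interval because `β_med` is determined by `P`. -/
theorem exists_compatible_iff (hP : ObsRegular P) {R2 : ℝ}
    (hR2 : R2 ∈ Set.Ioc (rSquaredMed P) 1) (δ b : ℝ) :
    (∃ Q : Measure (Full d), Compatible P δ R2 Q ∧ betaLong Q = b) ↔ b ∈ setBI P δ R2 := by
  constructor
  · rintro ⟨Q, h, rfl⟩
    have := h.isProbabilityMeasure
    have hQ := h.extends
    have hpd := h.a1.posDef_long
    refine ⟨?_, ?_⟩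
    · have := (hQ.assumptionA2_iff hP hpd h.a3 δ).1 h.a2
      rwa [h.r2] at this
    · intro h0
      exact h.a3.1 ((hQ.gammaOneLong_eq hP hpd).trans h0)
  · rintro ⟨hroot, hexc⟩
    obtain ⟨Q, hprob, hQ, hpd, rfl, rfl⟩ := exists_extends_betaLong_eq hP hR2 b
    have h3 : AssumptionA3 Q := by
      refine ⟨fun h0 => hexc ?_, hQ.gammaTwoLong_ne_zero hP hpd hR2.1⟩
      exact (hQ.gammaOneLong_eq hP hpd).symm.trans h0
    refine ⟨Q, ⟨hprob, hQ.marginal, ⟨hQ.memLp_comp_fst hP.memLp_obsY,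
      hQ.memLp_longRegressors hP, hpd, ?_⟩, (hQ.assumptionA2_iff hP hpd h3 δ).2 hroot, h3,
      hQ.cov_fullW1_fullW2, hQ.variance_fullW2, rfl⟩, rfl⟩
    -- The last clause of A1 concerns only the observed marginal, so it is inherited from `P`.
    have e : (varMatrix Q fun i (q : Full d) => obsVector (d := d) i q.1)
        = varMatrix P obsVector := by
      ext i j
      exact hQ.cov_comp_fst (hP.finite_var i) (hP.finite_var j)
    rw [e]
    exact hP.posDef

end Identification

end OVB

theorem mainTheorem6 (d : ℕ) (P : Measure (OVB.Obs d)) [IsProbabilityMeasure P]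
    (hP : OVB.ObsRegular P) (δbar R2 : ℝ) (hδbar : 0 ≤ δbar)
    (hR2 : R2 ∈ Set.Ioc (OVB.rSquaredMed P) 1) :
    OVB.identifiedSet P δbar R2 = ⋃ δ ∈ {δ : ℝ | |δ| ≤ δbar}, OVB.setBI P δ R2 ∧
    ∀ M : ℝ, 0 ≤ M →
      OVB.identifiedSetMag P δbar R2 M =
        ⋃ δ ∈ {δ : ℝ | |δ| ≤ δbar}, OVB.setBIMag P δ R2 M := by
  constructor
  · ext b
    simp only [OVB.identifiedSet, Set.mem_ofPred_eq, Set.mem_iUnion, exists_prop,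
      ← OVB.exists_compatible_iff hP hR2]
    constructor
    · rintro ⟨Q, δ, hδ, hQ⟩
      exact ⟨δ, hδ, Q, hQ⟩
    · rintro ⟨δ, hδ, Q, hQ⟩
      exact ⟨Q, δ, hδ, hQ⟩
  · intro M _
    ext b
    have habs : |b - OVB.betaMed P| ≤ M ↔
        b ∈ Set.Icc (OVB.betaMed P - M) (OVB.betaMed P + M) := by
      rw [abs_sub_le_iff, Set.mem_Icc]
      constructor <;> rintro ⟨h1, h2⟩ <;> constructor <;> linarith
    simp only [OVB.identifiedSetMag, OVB.setBIMag, Set.mem_ofPred_eq, Set.mem_iUnion, exists_prop,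
      Set.mem_inter_iff, ← OVB.exists_compatible_iff hP hR2, ← habs]
    constructor
    · rintro ⟨Q, δ, hδ, hQ, hM, rfl⟩
      exact ⟨δ, hδ, ⟨Q, hQ, rfl⟩, hM⟩
    · rintro ⟨δ, hδ, ⟨Q, hQ, rfl⟩, hM⟩
      exact ⟨Q, δ, hδ, hQ, hM, rfl⟩
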